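/- Let $r\ge 2$ be an integer and let $F$ be a finite graph with $\mathrm{ex}(n,F)=t_r(n)+O(1)$ as $n\to\infty$, where $\mathrm{ex}(n,F)$ is the maximum number of edges of an $n$-vertex graph that does not contain $F$ as a subgraph and $t_r(n)$ is the number of edges of the balanced complete $r$-partite graph on $n$ vertices. Let $c_0$ be the integer $$c_0=\lim_{k\to\infty}\,\sup_{n\ge k}\bigl(\mathrm{ex}(n,F)-t_r(n)\bigr).$$ There is an $\varepsilon_0=\varepsilon_0(F,r)>0$ such that for every $0<\varepsilon<\varepsilon_0$ there is an $N=N(F,r,\varepsilon)$ with the following property. Let $G$ be a graph on $n\ge N$ vertices that does not contain $F$ as a subgraph and has minimum degree greater than $\left(1-\frac1r-\varepsilon\right)n$. Then: (i) There is a partition $V_1,\dots,V_r$ of $V(G)$, unique up to the order of the parts (also among partitions in which empty parts are allowed), such that for every $i$ at most $c_0$ edges of $G$ have both ends in $V_i$. Moreover, for $1\le i\le r$, $$\left(\tfrac1r-3\sqrt{\varepsilon}\right)n<|V_i|<\left(\tfrac1r+3\sqrt{\varepsilon}\right)n .$$ (ii) For this partition, $e(G_{in})-e(G_{out})\le c_0$,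 where $G_{in}$ is the graph on $V(G)$ whose edges are the edges of $G$ with both ends in the same part, and $G_{out}$ is the graph on $V(G)$ whose edges are the pairs of vertices in different parts that are not adjacent in $G$. -/

import Mathlib

namespace TuranPartition

open SimpleGraph

/-- The number `t_r(n)` of edges of the Turán graph `T_r(n)`. -/
def turanEdges (r n : ℕ) : ℕ := (turanGraph n r).edgeFinset.card

/-- The constant `c₀ = lim_{k → ∞} sup_{n ≥ k} (ex(n, F) - t_r(n))`, as an integer. -/
noncomputable def excess {W : Type*} (F : SimpleGraph W) (r : ℕ) : ℤ :=
  Filter.limsup (fun n : ℕ => (extremalNumber n F : ℤ) - (turanEdges r n : ℤ)) Filter.atTop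

variable {V : Type*}

/-- `e(H)`, the number of edges of a graph. -/
noncomputable def numEdges (H : SimpleGraph V) : ℕ := H.edgeSet.ncard

/-- `E(A)`: the edges of `G` with both ends in `A`. -/
def edgesWithin (G : SimpleGraph V) (A : Finset V) : Set (Sym2 V) :=
  {e | e ∈ G.edgeSet ∧ ∀ v ∈ e, v ∈ A}

/-- The missing edges between `A` and `B`: pairs with one end in `A` and the other in `B` that are
not edges of `G`. -/
def missingBetween (G : SimpleGraph V) (A B : Finset V) : Set (Sym2 V) :=
  {e | e ∉ G.edgeSet ∧ ∃ a ∈ A, ∃ b ∈ B, e = s(a, b)}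

/-- `P 0, …, P (r - 1)` is a partition of the vertex set: every vertex lies in exactly one part. -/
def IsPartition {r : ℕ} (P : Fin r → Finset V) : Prop := ∀ v, ∃! i, v ∈ P i

/-- A partition of the vertex set in which every part spans at most `c` edges of `G`. -/
def IsSparsePartition {r : ℕ} (G : SimpleGraph V) (c : ℤ) (P : Fin r → Finset V) : Prop :=
  IsPartition P ∧ ∀ i, ((edgesWithin G (P i)).ncard : ℤ) ≤ c

/-- `G_in`: the graph on `V` formed by the edges of `G` inside the parts. -/
def inGraph {r : ℕ} (G : SimpleGraph V) (P : Fin r → Finset V) : SimpleGraph V :=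
  fromEdgeSet (⋃ i, edgesWithin G (P i))

/-- `G_out`: the graph on `V` formed by the missing edges between different parts. -/
def outGraph {r : ℕ} (G : SimpleGraph V) (P : Fin r → Finset V) : SimpleGraph V :=
  fromEdgeSet (⋃ i, ⋃ j, ⋃ _ : i ≠ j, missingBetween G (P i) (P j))

end TuranPartition

/-!
Write `c` for `excess F r`.  Since `ex(n, F) ≤ t_r(n) + c` for all large `n`, comparing the subgraph
of `G` on `r` disjoint `m`-sets with `K_r(m)` shows that an `F`-free graph has, for every large `m`
and every choice of such sets, at most `c` more edges inside the sets than it misses between them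
(`locallySparse_of_free`).  This is the only consequence of `F`-freeness that is used.  Together with
a greedy completion (`exists_complete_extension`) it says that a bounded set of vertices which is
almost completely joined to large, almost completely joined reservoirs spans at most `c` edges
(`LocallySparse.edgesWithin_le`); in particular no vertex has many neighbours in all `r` reservoirs
(`LocallySparse.exists_card_nbrsIn_lt`).

The minimum degree exceeds the Erdős–Stone threshold for complete `r`-partite subgraphs, so `G`
contains such a subgraph `B` with large parts of bounded size.  Every vertex has few neighbours in
some part of `B`; since each vertex of `B` has little more than `n / r` non-neighbours, double
counting shows that all but a small proportion of the vertices are adjacent to almost all of the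
other parts.  They fall into `r` classes with bounded inner degrees
(`LocallySparse.exists_classes`), hence of size about `n / r` and almost completely joined to each
other.  Every vertex has few neighbours in some class and, by the minimum degree, is then joined to
almost all of the other classes; putting it with that class yields a partition, whose parts span at
most `c` edges by `LocallySparse.edgesWithin_le`
(`LocallySparse.exists_isSparsePartition_of_classes`).

In any partition whose parts span at most `c` edges, the vertices of a part are non-neighbours of
almost all of that part.  So parts have size at most about `n / r`, hence about `n / r`, and two
parts of two such partitions with a common vertex coincide almost entirely, which forces the
partitions to agree up to order (`IsSparsePartition.exists_perm`).  As there are boundedly many inner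
edges, `r` sets of `m` vertices, one in each part, contain them all, and local sparseness gives the
inequality between inner and missing edges (`IsSparsePartition.numEdges_sub_le`).
-/

namespace TuranPartition

open SimpleGraph Finset

/-! ### Local sparseness of `F`-free graphs -/

theorem eventually_extremalNumber_le {W : Type*} (F : SimpleGraph W) (r : ℕ)
    (hF : (fun n : ℕ => (extremalNumber n F : ℝ) - (turanEdges r n : ℝ))
      =O[Filter.atTop] (fun _ => (1 : ℝ))) :
    ∀ᶠ n : ℕ in Filter.atTop, (extremalNumber n F : ℤ) ≤ turanEdges r n + excess F r := by
  obtain ⟨C, hC⟩ := hF.bound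
  have hb : ∀ᶠ n : ℕ in Filter.atTop,
      (extremalNumber n F : ℤ) - (turanEdges r n : ℤ) ≤ ⌈C⌉ := by
    filter_upwards [hC] with n hn
    have h1 := (le_abs_self _).trans hn
    simp only [norm_one, mul_one] at h1
    have h2 := h1.trans (Int.le_ceil C)
    exact_mod_cast h2
  have hlt : Filter.limsup (fun n : ℕ => (extremalNumber n F : ℤ) - (turanEdges r n : ℤ))
      Filter.atTop < excess F r + 1 := by
    unfold excess; omega
  filter_upwards [Filter.eventually_lt_of_limsup_lt hlt ⟨_, hb⟩] with n hn
  omega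

/-- Every choice of `r` disjoint sets of `m` vertices spans at most `c` more edges inside the sets
than it misses between them. -/
def LocallySparse {V : Type*} (G : SimpleGraph V) (r m : ℕ) (c : ℤ) : Prop :=
  ∀ A : Fin r → Finset V, Pairwise (fun i j => Disjoint (A i) (A j)) → (∀ i, #(A i) = m) →
    ((⋃ i, edgesWithin G (A i)).ncard : ℤ) ≤
      (⋃ i, ⋃ j, ⋃ _ : i ≠ j, missingBetween G (A i) (A j)).ncard + c

theorem turanEdges_mul (r m : ℕ) [DecidableRel (completeEquipartiteGraph r m).Adj] :
    turanEdges r (r * m) = #(completeEquipartiteGraph r m).edgeFinset := by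
  unfold turanEdges
  exact (Iso.card_edgeFinset_eq completeEquipartiteGraph.turanGraph).symm

/-- Deleting from a graph `H` on `r` groups of `m` vertices the edges between the groups leaves at
most as many edges as are missing between the groups, plus the excess of `H` over `T_r(rm)`. -/
theorem card_edgeFinset_sdiff_le {r m : ℕ} {c : ℤ} (H : SimpleGraph (Fin r × Fin m))
    (h : (H.edgeSet.ncard : ℤ) ≤ turanEdges r (r * m) + c) :
    ((H \ completeEquipartiteGraph r m).edgeSet.ncard : ℤ) ≤
      (completeEquipartiteGraph r m \ H).edgeSet.ncard + c := by
  classical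
  rw [turanEdges_mul, ← Set.ncard_coe_finset, coe_edgeFinset] at h
  rw [edgeSet_sdiff, edgeSet_sdiff]
  have h1 := Set.ncard_inter_add_ncard_sdiff_eq_ncard H.edgeSet
    (completeEquipartiteGraph r m).edgeSet
  have h2 := Set.ncard_inter_add_ncard_sdiff_eq_ncard (completeEquipartiteGraph r m).edgeSet
    H.edgeSet
  rw [Set.inter_comm] at h2
  omega

theorem locallySparse_of_free {V W : Type*} [Finite V] {F : SimpleGraph W} {G : SimpleGraph V}
    {r m : ℕ} {c : ℤ} (hG : F.Free G)
    (hm : (extremalNumber (r * m) F : ℤ) ≤ turanEdges r (r * m) + c) : LocallySparse G r m c := by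
  classical
  intro A hA hcard
  have e (i : Fin r) : Fin m ≃ A i := (Finset.equivFinOfCardEq (hcard i)).symm
  have hmem (x : Fin r × Fin m) : (e x.1 x.2 : V) ∈ A x.1 := (e x.1 x.2).2
  have hidx : ∀ {i j : Fin r} {v : V}, v ∈ A i → v ∈ A j → i = j := by
    intro i j v hi hj
    by_contra hne
    exact Finset.disjoint_left.1 (hA hne) hi hj
  let f : Fin r × Fin m ↪ V := ⟨fun x => e x.1 x.2, by
    rintro ⟨i, a⟩ ⟨j, b⟩ h
    have h' : (e i a : V) = e j b := h
    obtain rfl : i = j := hidx (e i a).2 (h' ▸ (e j b).2)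
    simpa using (e i).injective (Subtype.ext h')⟩
  have hf : ∀ {i v}, v ∈ A i → ∃ x : Fin r × Fin m, x.1 = i ∧ f x = v := by
    intro i v hv
    refine ⟨(i, (e i).symm ⟨v, hv⟩), rfl, ?_⟩
    change ((e i ((e i).symm ⟨v, hv⟩) : A i) : V) = v
    simp
  set H := G.comap f with hH
  have hfree : F.Free H := fun h => hG (h.trans ⟨(Embedding.comap f G).toCopy⟩)
  have hedge : (H.edgeSet.ncard : ℤ) ≤ turanEdges r (r * m) + c := by
    refine le_trans ?_ hm
    have := card_edgeFinset_le_extremalNumber hfree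
    rw [Fintype.card_prod, Fintype.card_fin, Fintype.card_fin] at this
    rw [← coe_edgeFinset, Set.ncard_coe_finset]
    exact_mod_cast this
  have key := card_edgeFinset_sdiff_le H hedge
  have hinj : Function.Injective (Sym2.map f) := Sym2.map.injective f.injective
  have hin : (⋃ i, edgesWithin G (A i)).ncard ≤
      (H \ completeEquipartiteGraph r m).edgeSet.ncard := by
    rw [← Set.ncard_image_of_injective _ hinj]
    refine Set.ncard_le_ncard ?_ (Set.toFinite _)
    intro s hs
    obtain ⟨i, hi, hiA⟩ := Set.mem_iUnion.1 hs
    induction s with | _ u v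
    obtain ⟨x, hx, rfl⟩ := hf (hiA u (Sym2.mem_mk_left _ _))
    obtain ⟨y, hy, rfl⟩ := hf (hiA v (Sym2.mem_mk_right _ _))
    refine ⟨s(x, y), ?_, rfl⟩
    simp only [mem_edgeSet, sdiff_adj, completeEquipartiteGraph_adj, hx, hy, ne_eq,
      not_true_eq_false, not_false_eq_true, and_true]
    exact hi
  have hout : (completeEquipartiteGraph r m \ H).edgeSet.ncard ≤
      (⋃ i, ⋃ j, ⋃ _ : i ≠ j, missingBetween G (A i) (A j)).ncard := by
    rw [← Set.ncard_image_of_injective _ hinj]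
    refine Set.ncard_le_ncard ?_ (Set.toFinite _)
    rintro _ ⟨s, hs, rfl⟩
    induction s with | _ x y
    simp only [mem_edgeSet, sdiff_adj, completeEquipartiteGraph_adj] at hs
    simp only [Set.mem_iUnion]
    exact ⟨x.1, y.1, hs.1, hs.2, _, hmem x, _, hmem y, rfl⟩
  omega

/-- Finitely many edges inside `A` are spanned by at most twice as many vertices of `A`. -/
theorem exists_subset_edgesWithin {V : Type*} {G : SimpleGraph V} {A : Finset V}
    (s : Finset (Sym2 V)) (hs : (s : Set (Sym2 V)) ⊆ edgesWithin G A) :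
    ∃ X ⊆ A, #X ≤ 2 * #s ∧ (s : Set (Sym2 V)) ⊆ edgesWithin G X := by
  classical
  refine ⟨s.biUnion Sym2.toFinset, ?_, ?_, ?_⟩
  · intro v hv
    obtain ⟨e, he, hve⟩ := Finset.mem_biUnion.1 hv
    exact (hs he).2 v (Sym2.mem_toFinset.1 hve)
  · rw [mul_comm]
    exact Finset.card_biUnion_le_card_mul _ _ _ fun e _ => by
      rw [Sym2.card_toFinset]; split_ifs <;> omega
  · intro e he
    exact ⟨(hs he).1, fun v hv => Finset.mem_biUnion.2 ⟨e, he, Sym2.mem_toFinset.2 hv⟩⟩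

/-- The non-neighbours of `v` in `C`, among them `v` itself if it lies in `C`. -/
noncomputable def nonNbrs {V : Type*} (G : SimpleGraph V) (v : V) (C : Finset V) : Finset V :=
  open Classical in C.filter fun w => ¬ G.Adj v w

/-- The neighbours of `v` in `C`. -/
noncomputable def nbrsIn {V : Type*} (G : SimpleGraph V) (v : V) (C : Finset V) : Finset V :=
  open Classical in C.filter fun w => G.Adj v w

theorem card_nbrsIn_add_card_nonNbrs {V : Type*} (G : SimpleGraph V) (v : V) (C : Finset V) :
    #(nbrsIn G v C) + #(nonNbrs G v C) = #C := by
  classical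
  exact Finset.card_filter_add_card_filter_not _

theorem mem_nbrsIn {V : Type*} {G : SimpleGraph V} {v w : V} {C : Finset V} :
    w ∈ nbrsIn G v C ↔ w ∈ C ∧ G.Adj v w := by simp [nbrsIn]

theorem mem_nonNbrs {V : Type*} {G : SimpleGraph V} {v w : V} {C : Finset V} :
    w ∈ nonNbrs G v C ↔ w ∈ C ∧ ¬ G.Adj v w := by simp [nonNbrs]

theorem nonNbrs_subset_nonNbrs {V : Type*} {G : SimpleGraph V} {v : V} {C C' : Finset V}
    (h : C ⊆ C') : nonNbrs G v C ⊆ nonNbrs G v C' := fun w hw => by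
  rw [mem_nonNbrs] at *; exact ⟨h hw.1, hw.2⟩

theorem card_edgesWithin_ge_of_star {V : Type*} [Finite V] {G : SimpleGraph V} {v : V}
    {X T : Finset V} (hv : v ∈ X) (hT : T ⊆ X) (hadj : ∀ w ∈ T, G.Adj v w) :
    #T ≤ (edgesWithin G X).ncard := by
  rw [← Set.ncard_coe_finset]
  refine Set.ncard_le_ncard_of_injOn (fun w => s(v, w)) ?_ ?_ (Set.toFinite _)
  · intro w hw
    refine ⟨hadj w hw, ?_⟩
    intro u hu
    rcases Sym2.mem_iff.1 hu with rfl | rfl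
    exacts [hv, hT hw]
  · intro a _ b _ h
    exact Sym2.congr_right.1 h

/-! ### Greedy completion to complete multipartite patterns -/

/-- Greedy completion: a family of small, mutually completely joined sets `A j` grows inside large
reservoirs `C j` to such a family of sets of size `m`, provided that every vertex in play misses at
most `D` vertices of each reservoir other than its own. -/
theorem exists_complete_extension {V : Type*} {G : SimpleGraph V} {r m D : ℕ}
    {C : Fin r → Finset V} (hC : ∀ j, r * m * (D + 1) ≤ #(C j))
    (hCC : ∀ k j, k ≠ j → ∀ v ∈ C k, #(nonNbrs G v (C j)) ≤ D)
    (A : Fin r → Finset V) (hA : ∀ j, #(A j) ≤ m)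
    (hAC : ∀ k j, k ≠ j → ∀ v ∈ A k, #(nonNbrs G v (C j)) ≤ D)
    (hAA : ∀ k j, k ≠ j → ∀ v ∈ A k, ∀ w ∈ A j, G.Adj v w) :
    ∃ A' : Fin r → Finset V, (∀ j, A j ⊆ A' j) ∧ (∀ j, #(A' j) = m) ∧
      ∀ k j, k ≠ j → ∀ v ∈ A' k, ∀ w ∈ A' j, G.Adj v w := by
  classical
  -- Induction on the number of vertices still to be added.
  induction hd : ∑ j, (m - #(A j)) generalizing A with
  | zero =>
    refine ⟨A, fun _ => subset_rfl, fun j => ?_, hAA⟩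
    have := (Finset.sum_eq_zero_iff.1 hd) j (Finset.mem_univ j)
    have := hA j
    omega
  | succ d ih =>
    obtain ⟨j, -, hj⟩ : ∃ j ∈ Finset.univ, m - #(A j) ≠ 0 := by
      apply Finset.exists_ne_zero_of_sum_ne_zero
      omega
    set bad := ((univ.erase j).biUnion fun k => (A k).biUnion fun v => nonNbrs G v (C j)) ∪ A j
    have hbad : #bad < #(C j) := by
      refine lt_of_lt_of_le ?_ (hC j)
      have h1 : #((univ.erase j).biUnion fun k => (A k).biUnion fun v => nonNbrs G v (C j)) ≤
          #(univ.erase j) * (m * D) := by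
        refine Finset.card_biUnion_le_card_mul _ _ _ fun k hk => ?_
        refine (Finset.card_biUnion_le_card_mul _ _ D fun v hv =>
          hAC k j (Finset.ne_of_mem_erase hk) v hv).trans ?_
        exact Nat.mul_le_mul_right _ (hA k)
      have h2 : #(univ.erase j) * (m * D) ≤ r * (m * D) :=
        Nat.mul_le_mul_right _ ((Finset.card_le_univ _).trans (Fintype.card_fin r).le)
      have h3 : m ≤ r * m := Nat.le_mul_of_pos_left m j.pos
      have h4 := Finset.card_union_le
        ((univ.erase j).biUnion fun k => (A k).biUnion fun v => nonNbrs G v (C j)) (A j)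
      calc #bad ≤ _ := h4
        _ < r * (m * D) + r * m := by omega
        _ = _ := by ring
    obtain ⟨w, hwC, hw⟩ := Finset.exists_mem_notMem_of_card_lt_card hbad
    simp only [bad, Finset.mem_union, Finset.mem_biUnion, Finset.mem_erase, Finset.mem_univ,
      and_true, not_or, not_exists, not_and, mem_nonNbrs, not_not] at hw
    have hwadj : ∀ k, k ≠ j → ∀ v ∈ A k, G.Adj v w := fun k hk v hv => hw.1 k hk v hv hwC
    set A₁ := Function.update A j (insert w (A j)) with hA₁
    have hcj : #(A₁ j) = #(A j) + 1 := by
      rw [hA₁, Function.update_self, Finset.card_insert_of_notMem hw.2]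
    have hne : ∀ k, k ≠ j → A₁ k = A k := fun k hk => Function.update_of_ne hk _ _
    have hsub : ∀ k, A k ⊆ A₁ k := by
      intro k
      by_cases hk : k = j
      · subst hk
        rw [hA₁, Function.update_self]; exact Finset.subset_insert _ _
      · rw [hne k hk]
    have hmem : ∀ k, ∀ v ∈ A₁ k, v ∈ A k ∨ (k = j ∧ v = w) := by
      intro k v hv
      by_cases hk : k = j
      · subst hk
        rw [hA₁, Function.update_self, Finset.mem_insert] at hv
        tauto
      · rw [hne k hk] at hv; exact Or.inl hv
    have hA₁m : ∀ k, #(A₁ k) ≤ m := by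
      intro k
      by_cases hk : k = j
      · subst hk; omega
      · rw [hne k hk]; exact hA k
    have hA₁C : ∀ k l, k ≠ l → ∀ v ∈ A₁ k, #(nonNbrs G v (C l)) ≤ D := by
      intro k l hkl v hv
      rcases hmem k v hv with h | ⟨rfl, rfl⟩
      · exact hAC k l hkl v h
      · exact hCC k l hkl v hwC
    have hA₁A : ∀ k l, k ≠ l → ∀ v ∈ A₁ k, ∀ u ∈ A₁ l, G.Adj v u := by
      intro k l hkl v hv u hu
      rcases hmem k v hv with h | ⟨hk, rfl⟩ <;> rcases hmem l u hu with h' | ⟨hl, rfl⟩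
      · exact hAA k l hkl v h u h'
      · exact hwadj k (hl ▸ hkl) v h
      · exact (hwadj l (hk ▸ hkl.symm) u h').symm
      · exact absurd (hk.trans hl.symm) hkl
    have hd' : ∑ k, (m - #(A₁ k)) = d := by
      rw [← Finset.add_sum_erase _ _ (Finset.mem_univ j)] at hd ⊢
      have : ∑ k ∈ univ.erase j, (m - #(A₁ k)) = ∑ k ∈ univ.erase j, (m - #(A k)) :=
        Finset.sum_congr rfl fun k hk => by rw [hne k (Finset.ne_of_mem_erase hk)]
      omega
    obtain ⟨A', h1, h2, h3⟩ := ih A₁ hA₁m hA₁C hA₁A hd'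
    exact ⟨A', fun k => (hsub k).trans (h1 k), h2, h3⟩

/-- In a locally sparse graph, a small set that extends to a complete `r`-partite pattern spans few
edges. -/
theorem LocallySparse.edgesWithin_le {V : Type*} [Finite V] {G : SimpleGraph V} {r m D : ℕ}
    {c : ℤ} (hG : LocallySparse G r m c) {C : Fin r → Finset V}
    (hC : ∀ j, r * m * (D + 1) ≤ #(C j))
    (hCC : ∀ k j, k ≠ j → ∀ v ∈ C k, #(nonNbrs G v (C j)) ≤ D)
    {X : Finset V} (i : Fin r) (hX : #X ≤ m)
    (hXC : ∀ j, j ≠ i → ∀ v ∈ X, #(nonNbrs G v (C j)) ≤ D) :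
    ((edgesWithin G X).ncard : ℤ) ≤ c := by
  classical
  obtain ⟨A, hA, hcard, hadj⟩ := exists_complete_extension hC hCC
    (fun j => if j = i then X else ∅)
    (fun j => by split_ifs <;> simp [hX])
    (fun k j hkj v hv => by
      split_ifs at hv with h
      · exact hXC j (h ▸ hkj.symm) v hv
      · simp at hv)
    (fun k j hkj v hv w hw => by
      split_ifs at hv hw with h h'
      · exact absurd (h.trans h'.symm) hkj
      all_goals simp at hv hw)
  have hdisj : Pairwise fun i j => Disjoint (A i) (A j) := fun k j hkj =>
    Finset.disjoint_left.2 fun v hv hv' => G.irrefl (hadj k j hkj v hv v hv')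
  have key := hG A hdisj hcard
  have hout : (⋃ k, ⋃ j, ⋃ _ : k ≠ j, missingBetween G (A k) (A j)) = ∅ := by
    simp only [Set.iUnion_eq_empty]
    intro k j hkj
    rw [Set.eq_empty_iff_forall_notMem]
    rintro _ ⟨hn, a, ha, b, hb, rfl⟩
    exact hn (hadj k j hkj a ha b hb)
  rw [hout, Set.ncard_empty, Nat.cast_zero, zero_add] at key
  refine le_trans ?_ key
  have hXi : X ⊆ A i := by simpa using hA i
  have hsub : edgesWithin G X ⊆ ⋃ j, edgesWithin G (A j) :=
    fun e he => Set.mem_iUnion.2 ⟨i, he.1, fun v hv => hXi (he.2 v hv)⟩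
  exact_mod_cast Set.ncard_le_ncard hsub (Set.toFinite _)

/-- The star case of `LocallySparse.edgesWithin_le`: if `v` misses few vertices of each reservoir
`C j` with `j ≠ i`, then fewer than `m` of its neighbours have that property too. -/
theorem LocallySparse.card_lt_of_star {V : Type*} [Finite V] {G : SimpleGraph V} {r m D : ℕ}
    {c : ℤ} (hG : LocallySparse G r m c) (hm : c + 2 ≤ m) (hm1 : 1 ≤ m) {C : Fin r → Finset V}
    (hC : ∀ j, r * m * (D + 1) ≤ #(C j))
    (hCC : ∀ k j, k ≠ j → ∀ v ∈ C k, #(nonNbrs G v (C j)) ≤ D)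
    (i : Fin r) {v : V} (hv : ∀ j, j ≠ i → #(nonNbrs G v (C j)) ≤ D) {T : Finset V}
    (hT : ∀ w ∈ T, G.Adj v w) (hTC : ∀ j, j ≠ i → ∀ w ∈ T, #(nonNbrs G w (C j)) ≤ D) :
    #T < m := by
  classical
  by_contra! hle
  obtain ⟨T', hT', hcard⟩ := Finset.exists_subset_card_eq ((Nat.sub_le m 1).trans hle)
  have h1 := hG.edgesWithin_le hC hCC (X := insert v T') i
    ((Finset.card_insert_le _ _).trans (by omega)) (fun j hj w hw => by
      rcases Finset.mem_insert.1 hw with rfl | hw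
      · exact hv j hj
      · exact hTC j hj w (hT' hw))
  have h2 := card_edgesWithin_ge_of_star (G := G) (Finset.mem_insert_self v T')
    (Finset.subset_insert v T') fun w hw => hT w (hT' hw)
  omega

/-- If a vertex had many neighbours in each of several nearly complete reservoirs, they would contain
a complete `r`-partite pattern, in which the vertex and its neighbours in one reservoir form a star
with more than `c` edges. -/
theorem LocallySparse.exists_card_nbrsIn_lt {V : Type*} [Finite V] {G : SimpleGraph V}
    {r m D : ℕ} {c : ℤ} (hG : LocallySparse G r m c) (hm : c + 2 ≤ m) (hm1 : 1 ≤ m) (hr : 0 < r)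
    {C : Fin r → Finset V}
    (hCC : ∀ k j, k ≠ j → ∀ v ∈ C k, #(nonNbrs G v (C j)) ≤ D) (v : V) :
    ∃ i, #(nbrsIn G v (C i)) < r * m * (D + 1) := by
  classical
  by_contra! h
  have hsub : ∀ j, nbrsIn G v (C j) ⊆ C j := fun j w hw => (mem_nbrsIn.1 hw).1
  have hCC' : ∀ k j, k ≠ j → ∀ w ∈ nbrsIn G v (C k), #(nonNbrs G w (nbrsIn G v (C j))) ≤ D :=
    fun k j hkj w hw => (Finset.card_le_card (nonNbrs_subset_nonNbrs (hsub j))).trans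
      (hCC k j hkj w (hsub k hw))
  have hv : ∀ j, #(nonNbrs G v (nbrsIn G v (C j))) ≤ D := fun j => by
    have : nonNbrs G v (nbrsIn G v (C j)) = ∅ := by
      ext w; simp only [mem_nonNbrs, mem_nbrsIn, Finset.notMem_empty]; tauto
    simp [this]
  have := hG.card_lt_of_star hm hm1 (C := fun j => nbrsIn G v (C j)) h hCC' ⟨0, hr⟩
    (v := v) (fun j _ => hv j) (T := nbrsIn G v (C ⟨0, hr⟩)) (fun w hw => (mem_nbrsIn.1 hw).2)
    (fun j hj w hw => hCC' _ j hj.symm w hw)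
  have h0 := h ⟨0, hr⟩
  have : m ≤ r * m * (D + 1) :=
    (Nat.le_mul_of_pos_left m hr).trans (Nat.le_mul_of_pos_right _ (Nat.succ_pos D))
  omega

/-! ### Uniqueness and size of sparse partitions -/

theorem IsPartition.eq_of_mem {V : Type*} {r : ℕ} {P : Fin r → Finset V} (hP : IsPartition P)
    {i j : Fin r} {v : V} (hi : v ∈ P i) (hj : v ∈ P j) : i = j :=
  (hP v).unique hi hj

theorem IsPartition.disjoint {V : Type*} {r : ℕ} {P : Fin r → Finset V} (hP : IsPartition P)
    {i j : Fin r} (h : i ≠ j) : Disjoint (P i) (P j) :=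
  Finset.disjoint_left.2 fun _ hi hj => h (hP.eq_of_mem hi hj)

theorem IsPartition.sum_card {V : Type*} [Fintype V] {r : ℕ} {P : Fin r → Finset V}
    (hP : IsPartition P) : ∑ i, #(P i) = Fintype.card V := by
  classical
  rw [← Finset.card_biUnion fun i _ j _ h => hP.disjoint h, ← Finset.card_univ]
  congr 1
  ext v
  obtain ⟨i, hi, -⟩ := hP v
  simpa using ⟨i, hi⟩

theorem card_edgesWithin_nbrsIn_le {V : Type*} [Finite V] {G : SimpleGraph V} {A : Finset V}
    {v : V} (hv : v ∈ A) : #(nbrsIn G v A) ≤ (edgesWithin G A).ncard :=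
  card_edgesWithin_ge_of_star hv (fun _ hw => (mem_nbrsIn.1 hw).1) fun _ hw => (mem_nbrsIn.1 hw).2

/-- A part spanning few edges has hardly more vertices than a vertex may have non-neighbours. -/
theorem IsSparsePartition.card_le {V : Type*} [Fintype V] {G : SimpleGraph V} {r m : ℕ} {c : ℤ}
    {P : Fin r → Finset V} (hP : IsSparsePartition G c P) (hm : c ≤ m) {L : ℝ} (hL0 : 0 ≤ L)
    (hL : ∀ v, (#(nonNbrs G v univ) : ℝ) ≤ L) (i : Fin r) : (#(P i) : ℝ) ≤ L + m := by
  rcases (P i).eq_empty_or_nonempty with h | ⟨v, hv⟩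
  · rw [h]; simp; positivity
  have h1 := card_nbrsIn_add_card_nonNbrs G v (P i)
  have h2 := card_edgesWithin_nbrsIn_le (G := G) hv
  have h3 : #(nbrsIn G v (P i)) ≤ m := by have := hP.2 i; omega
  have h4 : (#(nonNbrs G v (P i)) : ℝ) ≤ #(nonNbrs G v univ) := by
    exact_mod_cast Finset.card_le_card (nonNbrs_subset_nonNbrs (Finset.subset_univ _))
  have h5 : (#(nbrsIn G v (P i)) : ℝ) ≤ m := by exact_mod_cast h3
  rw [← h1]; push_cast; linarith [hL v]

/-- An upper bound on all terms but one of a finite sum bounds the remaining term from below. -/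
theorem sub_le_of_sum {r : ℕ} {a : Fin r → ℝ} {B s : ℝ} (h : ∀ i, a i ≤ B) (hs : s ≤ ∑ i, a i)
    (i : Fin r) : s - (r - 1) * B ≤ a i := by
  rw [← Finset.add_sum_erase _ _ (Finset.mem_univ i)] at hs
  have h1 : ∑ j ∈ univ.erase i, a j ≤ #(univ.erase i) • B :=
    Finset.sum_le_card_nsmul _ _ _ fun j _ => h j
  rw [Finset.card_erase_of_mem (Finset.mem_univ i), Finset.card_univ, Fintype.card_fin,
    nsmul_eq_mul, Nat.cast_sub i.pos, Nat.cast_one] at h1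
  linarith

theorem IsSparsePartition.le_card {V : Type*} [Fintype V] {G : SimpleGraph V} {r m : ℕ} {c : ℤ}
    {P : Fin r → Finset V} (hP : IsSparsePartition G c P) (hm : c ≤ m) {L : ℝ} (hL0 : 0 ≤ L)
    (hL : ∀ v, (#(nonNbrs G v univ) : ℝ) ≤ L) (i : Fin r) :
    (Fintype.card V : ℝ) - (r - 1) * (L + m) ≤ #(P i) :=
  sub_le_of_sum (a := fun i => (#(P i) : ℝ)) (hP.card_le hm hL0 hL)
    (by rw [← hP.1.sum_card]; push_cast; rfl) i

/-- Two sparse parts with a common vertex overlap in more than half of the size of any part: apart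
from few vertices, both consist of non-neighbours of that vertex. -/
theorem IsSparsePartition.card_inter {V : Type*} [Fintype V] [DecidableEq V] {G : SimpleGraph V}
    {r m : ℕ} {c : ℤ} {P Q : Fin r → Finset V} (hP : IsSparsePartition G c P)
    (hQ : IsSparsePartition G c Q) (hm : c ≤ m) {L : ℝ} (hL0 : 0 ≤ L)
    (hL : ∀ v, (#(nonNbrs G v univ) : ℝ) ≤ L)
    (hn : L + m < 2 * (2 * ((Fintype.card V : ℝ) - (r - 1) * (L + m)) - L - 2 * m))
    {i j : Fin r} {v : V} (hi : v ∈ P i) (hj : v ∈ Q j) :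
    L + m < 2 * #(P i ∩ Q j) := by
  have h1 := card_edgesWithin_nbrsIn_le (G := G) hi
  have h2 := card_edgesWithin_nbrsIn_le (G := G) hj
  have h3 : P i ∪ Q j ⊆ nonNbrs G v univ ∪ nbrsIn G v (P i) ∪ nbrsIn G v (Q j) := by
    intro w
    simp only [Finset.mem_union, mem_nonNbrs, mem_nbrsIn, Finset.mem_univ]
    tauto
  have h4 := (Finset.card_le_card h3).trans
    ((Finset.card_union_le _ _).trans (Nat.add_le_add_right (Finset.card_union_le _ _) _))
  have h5 := Finset.card_union_add_card_inter (P i) (Q j)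
  have h6 := hP.2 i
  have h7 := hQ.2 j
  have h8 : #(P i) + #(Q j) ≤ #(P i ∩ Q j) + #(nonNbrs G v univ) + 2 * m := by omega
  have h9 : (#(P i) : ℝ) + #(Q j) ≤ #(P i ∩ Q j) + #(nonNbrs G v univ) + 2 * m := by
    exact_mod_cast h8
  linarith [hL v, hP.le_card hm hL0 hL i, hQ.le_card hm hL0 hL j]

theorem IsSparsePartition.subset_of_mem {V : Type*} [Fintype V] {G : SimpleGraph V}
    {r m : ℕ} {c : ℤ} {P Q : Fin r → Finset V} (hP : IsSparsePartition G c P)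
    (hQ : IsSparsePartition G c Q) (hm : c ≤ m) {L : ℝ} (hL0 : 0 ≤ L)
    (hL : ∀ v, (#(nonNbrs G v univ) : ℝ) ≤ L)
    (hn : L + m < 2 * (2 * ((Fintype.card V : ℝ) - (r - 1) * (L + m)) - L - 2 * m))
    {i j : Fin r} {v : V} (hi : v ∈ P i) (hj : v ∈ Q j) : P i ⊆ Q j := by
  classical
  intro w hw
  obtain ⟨k, hk, -⟩ := hQ.1 w
  obtain rfl | hjk := eq_or_ne k j
  · exact hk
  exfalso
  have h1 := hP.card_inter hQ hm hL0 hL hn hi hj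
  have h2 := hP.card_inter hQ hm hL0 hL hn hw hk
  have h3 : Disjoint (P i ∩ Q j) (P i ∩ Q k) :=
    (hQ.1.disjoint hjk.symm).mono Finset.inter_subset_right Finset.inter_subset_right
  have h4 : #(P i ∩ Q j) + #(P i ∩ Q k) ≤ #(P i) := by
    rw [← Finset.card_union_of_disjoint h3]
    exact Finset.card_le_card (Finset.union_subset Finset.inter_subset_left
      Finset.inter_subset_left)
  have h5 : (#(P i ∩ Q j) : ℝ) + #(P i ∩ Q k) ≤ #(P i) := by exact_mod_cast h4
  linarith [hP.card_le hm hL0 hL i]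

/-- Sparse partitions are unique up to the order of the parts. -/
theorem IsSparsePartition.exists_perm {V : Type*} [Fintype V] {G : SimpleGraph V}
    {r m : ℕ} {c : ℤ} {P Q : Fin r → Finset V} (hP : IsSparsePartition G c P)
    (hQ : IsSparsePartition G c Q) (hm : c ≤ m) {L : ℝ} (hL0 : 0 ≤ L)
    (hL : ∀ v, (#(nonNbrs G v univ) : ℝ) ≤ L)
    (hn : L + m < 2 * (2 * ((Fintype.card V : ℝ) - (r - 1) * (L + m)) - L - 2 * m))
    (hpos : 0 < (Fintype.card V : ℝ) - (r - 1) * (L + m)) :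
    ∃ σ : Equiv.Perm (Fin r), ∀ i, Q i = P (σ i) := by
  have hne : ∀ i, (Q i).Nonempty := fun i => by
    rw [← Finset.card_pos]
    exact_mod_cast hpos.trans_le (hQ.le_card hm hL0 hL i)
  have h : ∀ i, ∃ j, Q i = P j := fun i => by
    obtain ⟨v, hv⟩ := hne i
    obtain ⟨j, hj, -⟩ := hP.1 v
    exact ⟨j, (hQ.subset_of_mem hP hm hL0 hL hn hv hj).antisymm
      (hP.subset_of_mem hQ hm hL0 hL hn hj hv)⟩
  choose σ hσ using h
  have hinj : Function.Injective σ := fun i j hij => by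
    obtain ⟨v, hv⟩ := hne i
    exact hQ.1.eq_of_mem hv (by rwa [hσ j, ← hij, ← hσ i])
  exact ⟨Equiv.ofBijective σ (Finite.injective_iff_bijective.1 hinj), hσ⟩

theorem numEdges_inGraph_le {V : Type*} [Finite V] {G : SimpleGraph V} {r : ℕ}
    (P : Fin r → Finset V) :
    numEdges (inGraph G P) ≤ (⋃ i, edgesWithin G (P i)).ncard := by
  unfold numEdges inGraph
  rw [edgeSet_fromEdgeSet]
  exact Set.ncard_le_ncard Set.sdiff_subset (Set.toFinite _)

theorem le_numEdges_outGraph {V : Type*} [Finite V] {G : SimpleGraph V} {r : ℕ}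
    {P : Fin r → Finset V} (hP : IsPartition P) :
    (⋃ i, ⋃ j, ⋃ _ : i ≠ j, missingBetween G (P i) (P j)).ncard ≤ numEdges (outGraph G P) := by
  unfold numEdges outGraph
  rw [edgeSet_fromEdgeSet]
  refine Set.ncard_le_ncard (fun e he => ⟨he, fun hd => ?_⟩) (Set.toFinite _)
  simp only [Set.mem_iUnion] at he
  obtain ⟨i, j, hij, -, a, ha, b, hb, rfl⟩ := he
  have hab : a = b := by simpa using hd
  exact hij (hP.eq_of_mem ha (hab ▸ hb))

/-- The bound on inner minus missing edges passes from bounded patterns to the whole graph: since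
there are boundedly many inner edges, one pattern contains them all. -/
theorem IsSparsePartition.numEdges_sub_le {V : Type*} [Finite V] {G : SimpleGraph V} {r m : ℕ}
    {c : ℤ} {P : Fin r → Finset V} (hP : IsSparsePartition G c P) (hG : LocallySparse G r m c)
    (hm : 2 * c ≤ m) (hcard : ∀ i, m ≤ #(P i)) :
    (numEdges (inGraph G P) : ℤ) - (numEdges (outGraph G P) : ℤ) ≤ c := by
  classical
  have h : ∀ i, ∃ A, edgesWithin G (P i) ⊆ edgesWithin G A ∧ A ⊆ P i ∧ #A = m := by
    intro i
    have hfin : (edgesWithin G (P i)).Finite := Set.toFinite _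
    obtain ⟨X, hXP, hXc, hX⟩ := exists_subset_edgesWithin hfin.toFinset
      (by rw [Set.Finite.coe_toFinset])
    rw [Set.Finite.coe_toFinset] at hX
    rw [← Set.ncard_eq_toFinset_card _ hfin] at hXc
    have hXm : #X ≤ m := by have := hP.2 i; omega
    obtain ⟨A, hXA, hAP, hA⟩ := Finset.exists_subsuperset_card_eq hXP hXm (hcard i)
    exact ⟨A, fun e he => ⟨(hX he).1, fun v hv => hXA ((hX he).2 v hv)⟩, hAP, hA⟩
  choose A hAe hAP hA using h
  have key := hG A (fun i j hij => (hP.1.disjoint hij).mono (hAP i) (hAP j)) hA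
  have h1 := numEdges_inGraph_le (G := G) P
  have h2 := le_numEdges_outGraph (G := G) hP.1
  have h3 : (⋃ i, edgesWithin G (P i)).ncard ≤ (⋃ i, edgesWithin G (A i)).ncard :=
    Set.ncard_le_ncard (Set.iUnion_mono hAe) (Set.toFinite _)
  have h4 : (⋃ i, ⋃ j, ⋃ _ : i ≠ j, missingBetween G (A i) (A j)).ncard ≤
      (⋃ i, ⋃ j, ⋃ _ : i ≠ j, missingBetween G (P i) (P j)).ncard := by
    refine Set.ncard_le_ncard (Set.iUnion_mono fun i => Set.iUnion_mono fun j =>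
      Set.iUnion_mono fun _ => ?_) (Set.toFinite _)
    rintro _ ⟨hn, a, ha, b, hb, rfl⟩
    exact ⟨hn, a, hAP i ha, b, hAP j hb, rfl⟩
  omega

/-! ### Existence of a sparse partition -/

theorem sum_card_nonNbrs_comm {V : Type*} [Fintype V] (G : SimpleGraph V) (B : Finset V) :
    ∑ v, #(nonNbrs G v B) = ∑ b ∈ B, #(nonNbrs G b univ) := by
  classical
  have h := Finset.sum_card_bipartiteAbove_eq_sum_card_bipartiteBelow (s := (univ : Finset V))
    (t := B) (fun v w => ¬ G.Adj v w)
  have h1 : ∀ v, nonNbrs G v B = B.bipartiteAbove (fun v w => ¬ G.Adj v w) v := fun v => by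
    ext w; simp [mem_nonNbrs, Finset.mem_bipartiteAbove]
  have h2 : ∀ b, nonNbrs G b univ =
      (univ : Finset V).bipartiteBelow (fun v w => ¬ G.Adj v w) b := fun b => by
    ext w; simp [mem_nonNbrs, Finset.mem_bipartiteBelow, G.adj_comm b w]
  simp only [h1, h2]
  exact h

theorem card_nonNbrs_add_card_nonNbrs_le {V : Type*} [Fintype V] (G : SimpleGraph V) (v : V)
    {A B : Finset V} (h : Disjoint A B) :
    #(nonNbrs G v A) + #(nonNbrs G v B) ≤ #(nonNbrs G v univ) := by
  classical
  rw [← Finset.card_union_of_disjoint (h.mono (fun w hw => (mem_nonNbrs.1 hw).1)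
    fun w hw => (mem_nonNbrs.1 hw).1)]
  exact Finset.card_le_card (Finset.union_subset
    (nonNbrs_subset_nonNbrs (Finset.subset_univ _)) (nonNbrs_subset_nonNbrs (Finset.subset_univ _)))

/-- Around a complete `r`-partite pattern `B` with large parts, almost all vertices are classified
by the part of `B` to which they have few neighbours, in such a way that the vertices of one class
have few neighbours in their own class. -/
theorem LocallySparse.exists_classes {V : Type*} [Fintype V] {G : SimpleGraph V} {r m D : ℕ}
    {c : ℤ} (hG : LocallySparse G r m c) (hm : c + 2 ≤ m) (hm1 : 1 ≤ m) (hr : 0 < r)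
    {B : Fin r → Finset V} (hBB : ∀ k j, k ≠ j → ∀ v ∈ B k, ∀ w ∈ B j, G.Adj v w)
    (hB : ∀ j, #(B j) = r * m * (D + 1)) {L : ℝ}
    (hL : ∀ v, (#(nonNbrs G v univ) : ℝ) ≤ L) :
    ∃ U : Fin r → Finset V, Pairwise (fun i j => Disjoint (U i) (U j)) ∧
      (∀ i, ∀ v ∈ U i, #(nbrsIn G v (U i)) < m) ∧
      ((Fintype.card V : ℝ) - ∑ i, (#(U i) : ℝ)) * (D + 1) ≤
        r * (r * m * (D + 1)) * L - (r * m * (D + 1) - r * m) * Fintype.card V := by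
  classical
  have hBB' : ∀ k j, k ≠ j → ∀ v ∈ B k, #(nonNbrs G v (B j)) ≤ 0 := fun k j hkj v hv => by
    rw [nonpos_iff_eq_zero, Finset.card_eq_zero, Finset.eq_empty_iff_forall_notMem]
    exact fun w hw => (mem_nonNbrs.1 hw).2 (hBB k j hkj v hv w (mem_nonNbrs.1 hw).1)
  choose φ hφ using hG.exists_card_nbrsIn_lt hm hm1 hr hBB'
  -- `w v` counts the non-neighbours of `v` in the parts of `B` other than its own.
  set w : V → ℕ := fun v => ∑ j ∈ univ.erase (φ v), #(nonNbrs G v (B j)) with hw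
  set U : Fin r → Finset V := fun i => univ.filter fun v => φ v = i ∧ w v ≤ D with hU
  have hmemU : ∀ {i v}, v ∈ U i ↔ φ v = i ∧ w v ≤ D := by simp [hU]
  have hUB : ∀ i, ∀ v ∈ U i, ∀ j, j ≠ i → #(nonNbrs G v (B j)) ≤ D := by
    intro i v hv j hj
    obtain ⟨h1, h2⟩ := hmemU.1 hv
    refine le_trans ?_ h2
    exact Finset.single_le_sum (f := fun j => #(nonNbrs G v (B j))) (fun _ _ => Nat.zero_le _)
      (Finset.mem_erase.2 ⟨by rwa [h1], Finset.mem_univ j⟩)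
  refine ⟨U, ?_, ?_, ?_⟩
  · exact fun i j hij => Finset.disjoint_left.2 fun v hi hj =>
      hij ((hmemU.1 hi).1.symm.trans (hmemU.1 hj).1)
  · intro i v hv
    refine hG.card_lt_of_star hm hm1 (D := D) (fun j => (hB j).ge)
      (fun k j hkj x hx => (hBB' k j hkj x hx).trans (Nat.zero_le D)) i
      (fun j hj => hUB i v hv j hj) (fun x hx => (mem_nbrsIn.1 hx).2) ?_
    exact fun j hj x hx => hUB i x (mem_nbrsIn.1 hx).1 j hj
  · have hwv : ∀ v, w v + (r * m * (D + 1)) ≤ ∑ j, #(nonNbrs G v (B j)) + r * m := by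
      intro v
      rw [← Finset.add_sum_erase _ _ (Finset.mem_univ (φ v))]
      have h1 := card_nbrsIn_add_card_nonNbrs G v (B (φ v))
      have h2 := hφ v
      have h3 := hB (φ v)
      simp only [hw]
      omega
    have hsum : ∑ v, w v + Fintype.card V * (r * m * (D + 1)) ≤
        ∑ j, ∑ b ∈ B j, #(nonNbrs G b univ) + Fintype.card V * (r * m) := by
      have := Finset.sum_le_sum fun v (_ : v ∈ (univ : Finset V)) => hwv v
      rw [Finset.sum_add_distrib, Finset.sum_add_distrib, Finset.sum_comm] at this
      simp only [Finset.sum_const, Finset.card_univ, smul_eq_mul, sum_card_nonNbrs_comm] at this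
      exact this
    have hnon : (∑ j, ∑ b ∈ B j, (#(nonNbrs G b univ) : ℝ)) ≤ r * (r * m * (D + 1)) * L := by
      have h1 : ∀ j, ∑ b ∈ B j, (#(nonNbrs G b univ) : ℝ) ≤ (r * m * (D + 1)) * L := fun j => by
        refine (Finset.sum_le_card_nsmul _ _ L fun b _ => hL b).trans ?_
        rw [hB j, nsmul_eq_mul]; push_cast; exact le_rfl
      refine (Finset.sum_le_card_nsmul _ _ _ fun j _ => h1 j).trans ?_
      rw [Finset.card_univ, Fintype.card_fin, nsmul_eq_mul]
      linarith
    have hbad : Fintype.card V * (D + 1) ≤ ∑ i, #(U i) * (D + 1) + ∑ v, w v := by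
      have h1 : ∑ i, #(U i) = #(univ.filter fun v => w v ≤ D) := by
        rw [Finset.card_eq_sum_card_fiberwise (f := φ) (t := univ) (fun _ _ => by simp)]
        refine Finset.sum_congr rfl fun i _ => ?_
        congr 1
        ext v
        simp [hmemU, and_comm]
      rw [← Finset.sum_mul, h1, Finset.card_eq_sum_ones, Finset.sum_filter, Finset.sum_mul,
        ← Finset.sum_add_distrib, ← Finset.card_univ, Finset.card_eq_sum_ones, Finset.sum_mul]
      refine Finset.sum_le_sum fun v _ => ?_
      split_ifs <;> omega
    have hbad' : (Fintype.card V : ℝ) * (D + 1) ≤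
        (∑ i, (#(U i) : ℝ)) * (D + 1) + ∑ v, (w v : ℝ) := by
      rw [Finset.sum_mul]; exact_mod_cast hbad
    have hsum' : ∑ v, (w v : ℝ) + Fintype.card V * (r * m * (D + 1)) ≤
        (∑ j, ∑ b ∈ B j, (#(nonNbrs G b univ) : ℝ)) + Fintype.card V * (r * m) := by
      exact_mod_cast hsum
    linarith

/-- Nearly complete classes covering almost all vertices extend to a sparse partition: each vertex
joins a class in which it has few neighbours.  Here `K` is the common order of magnitude `n / r` of
the classes, `e` the slack in the minimum degree and `y` a bound for the number of unclassified
vertices. -/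
theorem LocallySparse.exists_isSparsePartition_of_classes {V : Type*} [Fintype V]
    {G : SimpleGraph V} {r m : ℕ} {c : ℤ} (hG : LocallySparse G r m c) (hm : 2 * c + 2 ≤ m)
    (hm2 : 2 ≤ m) (hr : 0 < r) {U : Fin r → Finset V}
    (hU : Pairwise fun i j => Disjoint (U i) (U j))
    (hUn : ∀ i, ∀ v ∈ U i, #(nbrsIn G v (U i)) < m) {K e y : ℝ}
    (hL : ∀ v, (#(nonNbrs G v univ) : ℝ) ≤ K + e)
    (hsum : r * K - y ≤ ∑ i, (#(U i) : ℝ)) (hK : K = 20 * (r * m) ^ 2 * y)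
    (he : 2 * r * (r * m) * e ≤ y) (hqe : (r * m : ℝ) ≤ e) :
    ∃ P : Fin r → Finset V, IsSparsePartition G c P := by
  classical
  have hr1 : (1 : ℝ) ≤ r := by exact_mod_cast hr
  have hm2' : (2 : ℝ) ≤ m := by exact_mod_cast hm2
  set q : ℝ := r * m with hq
  have hq2 : 2 ≤ q := by nlinarith
  have hmq : (m : ℝ) ≤ q := by nlinarith
  have he0 : 0 ≤ e := by linarith
  have hrq : (2 : ℝ) * r ≤ r * q := by nlinarith
  have hre : 4 * (r * e) ≤ y := by nlinarith
  have hre' : e ≤ r * e := by nlinarith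
  have hy0 : 0 ≤ y := by linarith
  have hqy : 2 * y ≤ q * y := by nlinarith
  have hqqy : 2 * (q * y) ≤ q ^ 2 * y := by nlinarith
  have hUsub : ∀ i, (#(U i) : ℝ) ≤ K + e + m := by
    intro i
    rcases (U i).eq_empty_or_nonempty with h | ⟨v, hv⟩
    · rw [h, Finset.card_empty, hK]; push_cast; positivity
    have h1 := card_nbrsIn_add_card_nonNbrs G v (U i)
    have h4 : (#(nonNbrs G v (U i)) : ℝ) ≤ #(nonNbrs G v univ) := by
      exact_mod_cast Finset.card_le_card (nonNbrs_subset_nonNbrs (Finset.subset_univ _))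
    have h5 : (#(nbrsIn G v (U i)) : ℝ) ≤ m := by exact_mod_cast (hUn i v hv).le
    rw [← h1]; push_cast; linarith [hL v]
  have hUge : ∀ i, K - 2 * y ≤ #(U i) := by
    intro i
    have h1 := sub_le_of_sum hUsub hsum i
    have h2 : (r - 1 : ℝ) * (K + e + m) ≤ r * K - K + r * e + q := by nlinarith
    linarith
  -- Missing vertices of a class: all but few of the non-neighbours of `v` lie in its own class.
  have hmiss : ∀ i v (s : ℝ), (#(nbrsIn G v (U i)) : ℝ) ≤ s → ∀ j, j ≠ i →
      (#(nonNbrs G v (U j)) : ℝ) ≤ e + 2 * y + s := by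
    intro i v s hs j hj
    have h1 := card_nonNbrs_add_card_nonNbrs_le G v (hU hj)
    have h2 := card_nbrsIn_add_card_nonNbrs G v (U i)
    have h1' : (#(nonNbrs G v (U j)) : ℝ) + #(nonNbrs G v (U i)) ≤ #(nonNbrs G v univ) := by
      exact_mod_cast h1
    have h2' : (#(nbrsIn G v (U i)) : ℝ) + #(nonNbrs G v (U i)) = #(U i) := by exact_mod_cast h2
    linarith [hL v, hUge i]
  set D := ⌊3 * y⌋₊ with hD
  set D' := ⌊5 * q * y⌋₊ with hD'
  have hDle : (D : ℝ) ≤ 3 * y := Nat.floor_le (by linarith)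
  have hDle' : (D' : ℝ) ≤ 5 * q * y := Nat.floor_le (by positivity)
  have hDD : D ≤ D' := Nat.floor_le_floor (by nlinarith)
  have hUU : ∀ k j, k ≠ j → ∀ v ∈ U k, #(nonNbrs G v (U j)) ≤ D := by
    intro k j hkj v hv
    refine Nat.le_floor ((hmiss k v m (by exact_mod_cast (hUn k v hv).le) j hkj.symm).trans ?_)
    linarith
  choose ψ hψ using hG.exists_card_nbrsIn_lt (by omega) (by omega) hr hUU
  refine ⟨fun i => univ.filter fun v => ψ v = i, fun v => ⟨ψ v, by simp, fun i hi => by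
    exact (by simpa using hi : ψ v = i).symm⟩, fun i => ?_⟩
  -- Too many edges in a part would contain a bounded subset `s` of edges which is still too large.
  by_contra! hlt
  obtain ⟨s, hs, hcard⟩ := Set.exists_subset_card_eq (n := (c + 1).toNat)
    (s := edgesWithin G (univ.filter fun v => ψ v = i)) (by omega)
  have hfin : s.Finite := Set.toFinite _
  rw [Set.ncard_eq_toFinset_card _ hfin] at hcard
  obtain ⟨X, hXP, hXc, hX⟩ := exists_subset_edgesWithin hfin.toFinset
    (by rw [Set.Finite.coe_toFinset]; exact hs)
  have hc : ((edgesWithin G X).ncard : ℤ) ≤ c := by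
    refine hG.edgesWithin_le (D := D') (C := U) (fun j => ?_)
      (fun k j hkj v hv => (hUU k j hkj v hv).trans hDD) i (by omega) fun j hj v hv => ?_
    · have h1 : ((r * m * (D' + 1) : ℕ) : ℝ) ≤ #(U j) := by
        push_cast
        rw [← hq]
        have := hUge j
        have h2 : q * D' ≤ q * (5 * q * y) := by gcongr
        nlinarith
      exact_mod_cast h1
    · obtain rfl : ψ v = i := by simpa using hXP hv
      have h1 : (#(nbrsIn G v (U (ψ v))) : ℝ) ≤ ((r * m * (D + 1) : ℕ) : ℝ) := by
        exact_mod_cast (hψ v).le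
      refine Nat.le_floor ((hmiss _ v _ h1 j hj).trans ?_)
      push_cast
      rw [← hq]
      have h2 : q * D ≤ q * (3 * y) := by gcongr
      nlinarith
  have h3 := Set.ncard_le_ncard hX (Set.toFinite _)
  rw [Set.ncard_coe_finset] at h3
  have h4 : (c + 1 : ℤ) ≤ (c + 1).toNat := Int.self_le_toNat _
  omega

/-! ### The structure theorem -/

/-- The minimum-degree Erdős–Stone theorem, phrased with sets of vertices in an arbitrary finite
graph: a minimum degree slightly below `(1 - 1 / r) n` exceeds the threshold `1 - 1 / (r - 1)` for
complete `r`-partite subgraphs. -/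
theorem exists_complete_parts {r : ℕ} (hr : 2 ≤ r) {ε : ℝ} (hε : ε < 1 / ((r : ℝ) - 1) - 1 / r)
    (t : ℕ) :
    ∃ N : ℕ, ∀ n : ℕ, N ≤ n → ∀ (V : Type*) [Fintype V] (G : SimpleGraph V) [DecidableRel G.Adj],
      Fintype.card V = n → (1 - 1 / (r : ℝ) - ε) * n ≤ G.minDegree →
      ∃ B : Fin r → Finset V, (∀ j, #(B j) = t) ∧
        ∀ k j, k ≠ j → ∀ v ∈ B k, ∀ w ∈ B j, G.Adj v w := by
  obtain ⟨s, rfl⟩ : ∃ s, r = s + 1 := ⟨r - 1, by omega⟩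
  obtain ⟨N, hN⟩ := Filter.eventually_atTop.1
    (eventually_completeEquipartiteGraph_isContained_of_minDegree (sub_pos.2 hε) s t)
  refine ⟨N, fun n hn V _ G _ hV hdeg => ?_⟩
  classical
  have e : Fin n ≃ V := (Fintype.equivFinOfCardEq hV).symm
  have hmin : (G.comap e).minDegree = G.minDegree := (Iso.comap e G).minDegree_eq
  obtain ⟨f⟩ := (hN n hn (G := G.comap e) (by
    rw [hmin]
    refine le_trans (le_of_eq ?_) hdeg
    push_cast
    ring)).trans ⟨(Iso.comap e G).toCopy⟩
  refine ⟨fun j => univ.map ⟨fun a => f (j, a), fun a b h => by simpa using f.injective h⟩,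
    fun j => by simp, fun k j hkj v hv w hw => ?_⟩
  simp only [Finset.mem_map, Finset.mem_univ, true_and] at hv hw
  obtain ⟨a, rfl⟩ := hv
  obtain ⟨b, rfl⟩ := hw
  exact f.toHom.map_adj (show (completeEquipartiteGraph (s + 1) t).Adj (k, a) (j, b) from hkj)

theorem card_nonNbrs_univ_add_degree {V : Type*} [Fintype V] (G : SimpleGraph V)
    [DecidableRel G.Adj] (v : V) : #(nonNbrs G v univ) + G.degree v = Fintype.card V := by
  rw [← Finset.card_univ, ← card_nbrsIn_add_card_nonNbrs G v univ, add_comm,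
    ← card_neighborFinset_eq_degree]
  congr 2
  ext w
  simp [mem_nbrsIn]

/-- The structure of a locally sparse graph with a complete `r`-partite pattern `B` and few
non-neighbours at each vertex.  Here `K` stands for `n / r`, `e` for `ε n`, and `y` for a small
multiple of `n`. -/
theorem LocallySparse.exists_structure {V : Type*} [Fintype V] {G : SimpleGraph V} {r m D : ℕ}
    {c : ℤ} (hG : LocallySparse G r m c) (hcm : 2 * c + 2 ≤ m) (hm2 : 2 ≤ m) (hr : 2 ≤ r)
    {B : Fin r → Finset V} (hBB : ∀ k j, k ≠ j → ∀ v ∈ B k, ∀ w ∈ B j, G.Adj v w)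
    (hB : ∀ j, #(B j) = r * m * (D + 1)) {K e y : ℝ}
    (hL : ∀ v, (#(nonNbrs G v univ) : ℝ) ≤ K + e) (hrK : r * K = Fintype.card V)
    (hKy : K = 20 * (r * m) ^ 2 * y) (hey : 2 * r * (r * m) * e ≤ y) (hqe : (r * m : ℝ) ≤ e)
    (hDy : (r * m : ℝ) * Fintype.card V ≤ y / 2 * D) :
    ∃ P : Fin r → Finset V, IsSparsePartition G c P ∧
      (∀ Q : Fin r → Finset V, IsSparsePartition G c Q →
        ∃ σ : Equiv.Perm (Fin r), ∀ i, Q i = P (σ i)) ∧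
      (∀ i, K - 2 * (r - 1) * e ≤ #(P i) ∧ (#(P i) : ℝ) ≤ K + 2 * e) ∧
      (numEdges (inGraph G P) : ℤ) - (numEdges (outGraph G P) : ℤ) ≤ c := by
  have hr2 : (2 : ℝ) ≤ r := by exact_mod_cast hr
  have hm2' : (2 : ℝ) ≤ m := by exact_mod_cast hm2
  have he0 : 0 < e := lt_of_lt_of_le (by positivity) hqe
  have hy0 : 0 ≤ y := le_trans (by positivity) hey
  obtain ⟨U, hUd, hUn, hUc⟩ := hG.exists_classes (by omega) (by omega) (by omega) hBB hB hL
  have hUsum : r * K - y ≤ ∑ i, (#(U i) : ℝ) := by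
    rw [← hrK] at hUc hDy
    have h1 : (r * K - ∑ i, (#(U i) : ℝ)) * (D + 1) ≤ y * (D + 1) := by
      refine hUc.trans ?_
      have h3 : r * (r * m) * e * (D + 1) ≤ y / 2 * (D + 1) := by
        gcongr; linarith
      calc _ = r * (r * m) * e * (D + 1) + (r * m) * (r * K) := by ring
        _ ≤ y / 2 * (D + 1) + y / 2 * D := add_le_add h3 hDy
        _ ≤ y * (D + 1) := by
          linarith
    have := le_of_mul_le_mul_right h1 (by positivity)
    linarith
  obtain ⟨P, hP⟩ := hG.exists_isSparsePartition_of_classes hcm hm2 (by omega) hUd hUn hL hUsum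
    hKy hey hqe
  have hcm' : c ≤ m := by omega
  generalize hq : (r * m : ℝ) = q at *
  have hq4 : 4 ≤ q := by nlinarith
  have hmq : (m : ℝ) ≤ q := by nlinarith
  have hre0 : 0 < r * e := by positivity
  have hre : 8 * (r * e) ≤ y := by nlinarith
  have hee : 2 * e ≤ r * e := by nlinarith
  have hKbig : 80 * y ≤ K := by
    have : 4 ≤ q ^ 2 := by nlinarith
    rw [hKy]; nlinarith
  have hL0 : 0 ≤ K + e := by linarith
  have hlow : K - 2 * (r - 1) * e ≤ (Fintype.card V : ℝ) - (r - 1) * (K + e + m) := by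
    rw [← hrK]
    have : (r - 1 : ℝ) * m ≤ (r - 1) * e :=
      mul_le_mul_of_nonneg_left (hmq.trans hqe) (by linarith)
    linarith
  refine ⟨P, hP, fun Q hQ => ?_, fun i => ⟨?_, ?_⟩, ?_⟩
  · refine hP.exists_perm hQ hcm' hL0 hL ?_ ?_
    · linarith
    · linarith
  · exact hlow.trans (hP.le_card hcm' hL0 hL i)
  · linarith [hP.card_le hcm' hL0 hL i]
  · refine hP.numEdges_sub_le hG (by omega) fun i => ?_
    have h1 := hP.le_card hcm' hL0 hL i
    have h2 : (m : ℝ) ≤ #(P i) := by linarith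
    exact_mod_cast h2

end TuranPartition

open TuranPartition SimpleGraph Finset in
theorem theorem3p1 {W : Type*} [Finite W] (F : SimpleGraph W) (r : ℕ) (hr : 2 ≤ r)
    (hF : (fun n : ℕ => (SimpleGraph.extremalNumber n F : ℝ) - (TuranPartition.turanEdges r n : ℝ))
      =O[Filter.atTop] (fun _ => (1 : ℝ))) :
    ∃ ε₀ : ℝ, 0 < ε₀ ∧ ∀ ε : ℝ, 0 < ε → ε < ε₀ →
      ∃ N : ℕ, ∀ n : ℕ, N ≤ n →
        ∀ (V : Type*) [Fintype V] (G : SimpleGraph V) [DecidableRel G.Adj],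
          Fintype.card V = n → F.Free G →
          (1 - 1 / (r : ℝ) - ε) * (n : ℝ) < (G.minDegree : ℝ) →
          ∃ P : Fin r → Finset V,
            TuranPartition.IsSparsePartition G (TuranPartition.excess F r) P ∧
            (∀ Q : Fin r → Finset V,
              TuranPartition.IsSparsePartition G (TuranPartition.excess F r) Q →
                ∃ σ : Equiv.Perm (Fin r), ∀ i, Q i = P (σ i)) ∧
            (∀ i, (1 / (r : ℝ) - 3 * √ε) * (n : ℝ) < ((P i).card : ℝ) ∧
              ((P i).card : ℝ) < (1 / (r : ℝ) + 3 * √ε) * (n : ℝ)) ∧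
            (TuranPartition.numEdges (TuranPartition.inGraph G P) : ℤ) -
              (TuranPartition.numEdges (TuranPartition.outGraph G P) : ℤ) ≤
                TuranPartition.excess F r := by
  set c := TuranPartition.excess F r with hc
  obtain ⟨m₀, hm₀⟩ := Filter.eventually_atTop.1 (eventually_extremalNumber_le F r hF)
  obtain ⟨m, hm₀m, hm2, hcm⟩ : ∃ m : ℕ, m₀ ≤ m ∧ 2 ≤ m ∧ 2 * c + 2 ≤ m :=
    ⟨max m₀ (max 2 (2 * c + 2).toNat), by omega, by omega, by omega⟩
  have hex : (extremalNumber (r * m) F : ℤ) ≤ turanEdges r (r * m) + c :=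
    hm₀ _ (hm₀m.trans (Nat.le_mul_of_pos_left m (by omega)))
  have hr2 : (2 : ℝ) ≤ r := by exact_mod_cast hr
  have hm2' : (2 : ℝ) ≤ m := by exact_mod_cast hm2
  set q : ℝ := r * m with hq
  have hq4 : 4 ≤ q := by nlinarith
  set D : ℕ := 40 * r * (r * m) ^ 3 with hD
  have hDq : (D : ℝ) = 40 * r * q ^ 3 := by rw [hD]; push_cast; rfl
  -- `D` and `ε₀` make `q / (D + 1)` and `r q ε` at most half of `y / n = 1 / (20 r q ^ 2)`.
  set ε₀ : ℝ := 1 / (40 * r ^ 2 * q ^ 3) with hε₀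
  have hq3 : 1 ≤ q ^ 3 := one_le_pow₀ (by linarith)
  have hε₀r : ε₀ * (40 * r ^ 2) ≤ 1 := by
    rw [hε₀, one_div_mul_eq_div, div_le_one (by positivity)]
    exact le_mul_of_one_le_right (by positivity) hq3
  have hε₀q : ε₀ * (40 * r ^ 2 * q ^ 3) = 1 := by
    rw [hε₀]; exact one_div_mul_cancel (by positivity)
  have hε₀0 : 0 < ε₀ := by positivity
  -- The distance from `1 - 1 / r - ε₀` to the Erdős–Stone threshold `1 - 1 / (r - 1)`.
  have hgap : 0 < 1 / ((r : ℝ) - 1) - 1 / r - ε₀ := by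
    have h1 : 1 / ((r : ℝ) - 1) - 1 / r = 1 / ((r - 1) * r) := by
      have : (r : ℝ) - 1 ≠ 0 := by linarith
      field_simp
      ring
    rw [h1, sub_pos, lt_div_iff₀ (by nlinarith)]
    nlinarith
  refine ⟨ε₀, hε₀0, fun ε hε hεlt => ?_⟩
  obtain ⟨N, hN⟩ := exists_complete_parts hr (hεlt.trans (sub_pos.1 hgap)) (r * m * (D + 1))
  refine ⟨max N ⌈q / ε⌉₊, fun n hn V _ G _ hV hfree hdeg => ?_⟩
  have hqn : q ≤ ε * n := by
    have := (Nat.le_ceil (q / ε)).trans (Nat.cast_le.2 ((le_max_right _ _).trans hn))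
    rwa [div_le_iff₀ hε, mul_comm] at this
  have hn0 : 0 < (n : ℝ) := pos_of_mul_pos_right (by linarith) hε.le
  obtain ⟨B, hBcard, hBB⟩ := hN n ((le_max_left _ _).trans hn) V G hV hdeg.le
  have hL : ∀ v, (#(nonNbrs G v univ) : ℝ) ≤ n / r + ε * n := by
    intro v
    have h1 := card_nonNbrs_univ_add_degree G v
    have h2 : (G.minDegree : ℝ) ≤ G.degree v := by exact_mod_cast G.minDegree_le_degree v
    have h3 : (#(nonNbrs G v univ) : ℝ) + G.degree v = n := by rw [← hV]; exact_mod_cast h1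
    have h4 : (1 - 1 / (r : ℝ) - ε) * n = n - n / r - ε * n := by ring
    linarith
  have hey : 2 * r * q * (ε * n) ≤ n / (20 * r * q ^ 2) := by
    rw [le_div_iff₀ (by positivity)]
    calc 2 * r * q * (ε * n) * (20 * r * q ^ 2) = ε * (40 * r ^ 2 * q ^ 3) * n := by ring
      _ ≤ ε₀ * (40 * r ^ 2 * q ^ 3) * n := by gcongr
      _ = n := by rw [hε₀q, one_mul]
  obtain ⟨P, hP, huniq, hsize, hedges⟩ :=
    (locallySparse_of_free hfree hex).exists_structure hcm hm2 hr hBB hBcard hL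
      (by rw [hV]; field_simp) (by rw [← hq]; field_simp) hey hqn
      (by rw [hV, hDq, ← hq]; apply le_of_eq; field_simp; ring)
  refine ⟨P, hP, huniq, fun i => ?_, hedges⟩
  -- The true deviation of the part sizes is of order `ε n`; here `r √ε ≤ 1`.
  have hsqrt : 0 < √ε := Real.sqrt_pos.2 hε
  have hsq : √ε * √ε = ε := Real.mul_self_sqrt hε.le
  have hrsq : r * √ε ≤ 1 := by
    refine (le_abs_self _).trans (abs_le_one_iff_mul_self_le_one.2 ?_)
    calc r * √ε * (r * √ε) = r ^ 2 * (√ε * √ε) := by ring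
      _ = r ^ 2 * ε := by rw [hsq]
      _ ≤ ε₀ * (40 * r ^ 2) := by nlinarith [sq_nonneg (r : ℝ)]
      _ ≤ 1 := hε₀r
  have hres : r * (ε * n) ≤ √ε * n := by
    nth_rewrite 1 [← hsq]
    calc r * (√ε * √ε * n) = r * √ε * (√ε * n) := by ring
      _ ≤ 1 * (√ε * n) := by gcongr
      _ = _ := one_mul _
  have hsn : 0 < √ε * n := by positivity
  have hεn : 0 < ε * n := by positivity
  have h2 : 2 * (ε * n) ≤ r * (ε * n) := by gcongr
  obtain ⟨h3, h4⟩ := hsize i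
  constructor
  · have : (1 / (r : ℝ) - 3 * √ε) * n = n / r - 3 * (√ε * n) := by ring
    linarith
  · have : (1 / (r : ℝ) + 3 * √ε) * n = n / r + 3 * (√ε * n) := by ring
    linarith
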